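/- Let $N\ge 0$ be an integer, and write $(a)_0=1$, $(a)_k=a(a+1)\cdots(a+k-1)$ for $k \ge 1$. For real $\alpha,\beta<-N$ and an integer $0\le n\le N$, let $$Q_n(x,\alpha,\beta,N)=\sum_{k=0}^{n}\frac{(-n)_k\,(n+\alpha+\beta+1)_k\,(-x)_k}{k!\,(\alpha+1)_k\,(-N)_k}$$ be the Hahn–Eberlein polynomial of degree $n$. Suppose that $\alpha+\beta<-2N-1$ and that $$n\le \tilde n(\alpha,\beta,N):=-\tfrac12\Bigl\{(\alpha+\beta-1)+\sqrt{(\alpha+\beta+1)(\alpha+\beta+1+2N)}\Bigr\}.$$ Then, for all real $x\in[0,N]$, $$|Q_n(x,\alpha,\beta,N)|\le\max\Bigl\{1,\frac{(\beta+1)_n}{(\alpha+1)_n}\Bigr\}=\max\bigl\{|Q_n(0,\alpha,\beta,N)|,\ |Q_n(N,\alpha,\beta,N)|\bigr\}.$$ -/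

import Mathlib

/-- The rising factorial `(a)_k = a (a + 1) ⋯ (a + k - 1)`, with `(a)_0 = 1`. -/
noncomputable def risingFactorial (a : ℝ) (k : ℕ) : ℝ :=
  (ascPochhammer ℝ k).eval a

/-- The Hahn polynomial
`Q_n(x, α, β, N) = ∑_{k=0}^n (-n)_k (n+α+β+1)_k (-x)_k / (k! (α+1)_k (-N)_k)`,
defined for `n = 0, …, N`. For `α, β < -N` these are the Hahn-Eberlein polynomials; the
denominators do not vanish there, as `k ≤ n ≤ N`. -/
noncomputable def hahnQ (n : ℕ) (x α β : ℝ) (N : ℕ) : ℝ :=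
  ∑ k ∈ Finset.range (n + 1),
    (risingFactorial (-(n : ℝ)) k * risingFactorial ((n : ℝ) + α + β + 1) k *
        risingFactorial (-x) k) /
      ((k.factorial : ℝ) * risingFactorial (α + 1) k * risingFactorial (-(N : ℝ)) k)

/-- The degree bound
`ñ(α, β, N) = -(1/2) {(α + β - 1) + √((α + β + 1)(α + β + 1 + 2N))}`. -/
noncomputable def degreeBound (α β : ℝ) (N : ℕ) : ℝ :=
  -(1 / 2) * ((α + β - 1) + Real.sqrt ((α + β + 1) * (α + β + 1 + 2 * (N : ℝ))))

/-! ### Rising factorials -/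

/-! Put ρ_m = (β+m)/(α+m). Recurrence in the degree (`hahnQ_recurrence`): a_m (Q_{m+1} -
Q_m)/(1+ρ_{m+1}) = c_m ρ_m (Q_m - Q_{m-1})/(1+ρ_m) - x Q_m, where a_m + c_m = N. If α ≤ β, then ρ_m
≤ 1, and S_m = ((N-x)(Q_m - Q_{m-1})² + x(Q_m + ρ_m Q_{m-1})²)/(1+ρ_m)² does not increase while c_m
≤ a_m (`sonine_step`), which the degree bound guarantees. Since S_1 = x(N-x)/N and S_n ≥ Q_n²
x(N-x)/N by Cauchy-Schwarz, |Q_n| ≤ 1. If β ≤ α, the reflection x ↦ N - x, which swaps α and β,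
reduces to this case. -/

theorem risingFactorial_zero (a : ℝ) : risingFactorial a 0 = 1 := by
  simp [risingFactorial]

theorem risingFactorial_succ (a : ℝ) (k : ℕ) :
    risingFactorial a (k + 1) = risingFactorial a k * (a + k) := by
  simp [risingFactorial, ascPochhammer_succ_eval]

theorem risingFactorial_succ_left (a : ℝ) (k : ℕ) :
    risingFactorial a (k + 1) = a * risingFactorial (a + 1) k := by
  simp [risingFactorial, ascPochhammer_succ_left, Polynomial.eval_comp]

theorem risingFactorial_neg_natCast_of_lt {m k : ℕ} (h : m < k) :
    risingFactorial (-(m : ℝ)) k = 0 :=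
  ascPochhammer_eval_neg_coe_nat_of_lt h

theorem risingFactorial_ne_zero {a : ℝ} {k : ℕ} (h : ∀ i < k, a + i ≠ 0) :
    risingFactorial a k ≠ 0 := by
  induction k with
  | zero => simp [risingFactorial_zero]
  | succ k ih =>
    rw [risingFactorial_succ]
    exact mul_ne_zero (ih fun i hi => h i (by omega)) (h k (by omega))

/-! ### The three-term recurrence of the Hahn polynomials -/

/-- The coefficient of `(-x)_k` in the Hahn polynomial of degree `m`. -/
noncomputable def hahnCoeff (m : ℕ) (α β : ℝ) (N : ℕ) (k : ℕ) : ℝ :=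
  (risingFactorial (-(m : ℝ)) k * risingFactorial ((m : ℝ) + α + β + 1) k) /
    ((k.factorial : ℝ) * risingFactorial (α + 1) k * risingFactorial (-(N : ℝ)) k)

theorem hahnCoeff_zero (m : ℕ) (α β : ℝ) (N : ℕ) : hahnCoeff m α β N 0 = 1 := by
  simp [hahnCoeff, risingFactorial_zero]

theorem hahnQ_eq_sum {n M : ℕ} (h : n + 1 ≤ M) (x α β : ℝ) (N : ℕ) :
    hahnQ n x α β N = ∑ k ∈ Finset.range M, hahnCoeff n α β N k * risingFactorial (-x) k := by
  have h₁ : hahnQ n x α β N =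
      ∑ k ∈ Finset.range (n + 1), hahnCoeff n α β N k * risingFactorial (-x) k := by
    unfold hahnQ hahnCoeff
    exact Finset.sum_congr rfl fun k _ => by ring
  rw [h₁]
  refine Finset.sum_subset (Finset.range_mono h) fun k _ hk => ?_
  rw [hahnCoeff, risingFactorial_neg_natCast_of_lt (by simpa using hk)]
  simp

theorem hahnQ_zero_left (x α β : ℝ) (N : ℕ) : hahnQ 0 x α β N = 1 := by
  simp [hahnQ, risingFactorial_zero]

theorem hahnQ_at_zero (n : ℕ) (α β : ℝ) (N : ℕ) : hahnQ n 0 α β N = 1 := by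
  rw [hahnQ_eq_sum le_rfl, Finset.sum_range_succ', Finset.sum_eq_zero]
  · simp [hahnCoeff_zero, risingFactorial_zero]
  · intro k _
    rw [risingFactorial_succ_left]
    simp

theorem hahnQ_one (x α β : ℝ) (N : ℕ) (hα : α + 1 ≠ 0) (hN : (N : ℝ) ≠ 0) :
    hahnQ 1 x α β N = 1 - x * (α + β + 2) / ((α + 1) * N) := by
  simp only [hahnQ, Finset.sum_range_succ, Finset.sum_range_zero, risingFactorial_succ,
    risingFactorial_zero, Nat.factorial]
  push_cast
  simp only [one_mul, add_zero, mul_one, div_one, zero_add]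
  field_simp
  ring

/-- The weight of `Q_{m+1} - Q_m` in the three-term recurrence, up to the factor
`1 / (1 + hahnRatio (m+1))`. -/
noncomputable def hahnUp (α β : ℝ) (N m : ℕ) : ℝ :=
  (m + α + β + 1) * (N - m) / (2 * m + α + β + 1)

/-- The weight of `Q_m - Q_{m-1}` in the three-term recurrence, up to a factor depending on
`hahnRatio m`; `hahnUp` and `hahnDown` add up to `N`. -/
noncomputable def hahnDown (α β : ℝ) (N m : ℕ) : ℝ :=
  m * (m + α + β + 1 + N) / (2 * m + α + β + 1)

/-- The ratio of consecutive values of `(β+1)_m / (α+1)_m`. -/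
noncomputable def hahnRatio (α β : ℝ) (m : ℕ) : ℝ := (β + m) / (α + m)

/-- This is the coefficient of (-x)_{j+1} in `hahnQ_recurrence`. -/
theorem hahnCoeff_recurrence (N : ℕ) (α β : ℝ) (hα : α < -(N : ℝ)) (hβ : β < -(N : ℝ))
    (i : ℕ) (hi : i + 2 ≤ N) (j : ℕ) (hj : j ≤ i + 1) :
    hahnUp α β N (i + 1) / (1 + hahnRatio α β (i + 2)) *
        (hahnCoeff (i + 2) α β N (j + 1) - hahnCoeff (i + 1) α β N (j + 1)) -
      hahnDown α β N (i + 1) * hahnRatio α β (i + 1) / (1 + hahnRatio α β (i + 1)) *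
        (hahnCoeff (i + 1) α β N (j + 1) - hahnCoeff i α β N (j + 1)) =
      hahnCoeff (i + 1) α β N j - (j + 1) * hahnCoeff (i + 1) α β N (j + 1) := by
  have hiN : (i : ℝ) + 2 ≤ N := by exact_mod_cast hi
  have hji : (j : ℝ) ≤ i + 1 := by exact_mod_cast hj
  have hi0 : (0 : ℝ) ≤ i := Nat.cast_nonneg i
  have hj0 : (0 : ℝ) ≤ j := Nat.cast_nonneg j
  set m : ℝ := (i : ℝ) + 1 with hm
  set s : ℝ := α + β + 1 with hs
  set X := risingFactorial (-m) j with hX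
  set Y := risingFactorial (m + s) j with hY
  have hm0 : m ≠ 0 := by positivity
  have hms : m + s ≠ 0 := by linarith [hm, hs] |> fun h : m + s < 0 => h.ne
  -- Each rising factorial in degrees m-1, m, m+1 is `X` or `Y` times a rational factor, so only a
  -- rational identity in m, s, j remains (`d5`).
  have e1 : risingFactorial (-(m + 1)) (j + 1) = -(m + 1) * X := by
    rw [risingFactorial_succ_left, hX]; congr 2; ring
  have e2 : risingFactorial (m + 1 + s) (j + 1) = Y * (m + s + j) * (m + s + j + 1) / (m + s) := by
    rw [eq_div_iff hms, mul_comm, show m + 1 + s = m + s + 1 by ring,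
      ← risingFactorial_succ_left, risingFactorial_succ, risingFactorial_succ]
    push_cast; ring
  have e3 : risingFactorial (-m) (j + 1) = X * (-m + j) := risingFactorial_succ _ _
  have e4 : risingFactorial (m + s) (j + 1) = Y * (m + s + j) := risingFactorial_succ _ _
  have e5 : risingFactorial (-(m - 1)) (j + 1) = X * (-m + j) * (-m + j + 1) / (-m) := by
    rw [eq_div_iff (neg_ne_zero.2 hm0), mul_comm, show -(m - 1) = -m + 1 by ring,
      ← risingFactorial_succ_left, risingFactorial_succ, risingFactorial_succ]
    push_cast; ring
  have e6 : risingFactorial (m - 1 + s) (j + 1) = (m - 1 + s) * Y := by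
    rw [risingFactorial_succ_left, hY]; congr 2; ring
  have hP : risingFactorial (α + 1) j ≠ 0 := risingFactorial_ne_zero fun k hk => by
    have : (k : ℝ) + 1 ≤ j := by exact_mod_cast hk
    exact ne_of_lt (by linarith)
  have hR : risingFactorial (-(N : ℝ)) j ≠ 0 := risingFactorial_ne_zero fun k hk => by
    have : (k : ℝ) + 1 ≤ j := by exact_mod_cast hk
    exact ne_of_lt (by linarith)
  have hF : (j.factorial : ℝ) ≠ 0 := by positivity
  have hj1 : (j : ℝ) + 1 ≠ 0 := by positivity
  have hα1 : α + 1 + j ≠ 0 := ne_of_lt (by linarith)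
  have hN1 : -(N : ℝ) + j ≠ 0 := ne_of_lt (by linarith)
  have h2 : 2 * m + s ≠ 0 := ne_of_lt (by linarith)
  have h3 : 2 * m + s + 1 ≠ 0 := ne_of_lt (by linarith)
  have h4 : 2 * m + s - 1 ≠ 0 := ne_of_lt (by linarith)
  have hαm : α + m ≠ 0 := ne_of_lt (by linarith)
  have hαm1 : α + m + 1 ≠ 0 := ne_of_lt (by linarith)
  have hA : hahnUp α β N (i + 1) / (1 + hahnRatio α β (i + 2)) =
      (m + s) * (N - m) * (α + m + 1) / ((2 * m + s) * (2 * m + s + 1)) := by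
    have : 1 + hahnRatio α β (i + 2) = (2 * m + s + 1) / (α + m + 1) := by
      rw [hahnRatio]; push_cast
      rw [show α + ((i : ℝ) + 2) = α + m + 1 by rw [hm]; ring]
      field_simp; rw [hm, hs]; ring
    rw [this, hahnUp]; push_cast
    rw [← hm, show m + α + β + 1 = m + s by rw [hs]; ring,
      show 2 * m + α + β + 1 = 2 * m + s by rw [hs]; ring]
    field_simp
  have hC : hahnDown α β N (i + 1) * hahnRatio α β (i + 1) / (1 + hahnRatio α β (i + 1)) =
      m * (m + s + N) * (β + m) / ((2 * m + s) * (2 * m + s - 1)) := by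
    have : 1 + hahnRatio α β (i + 1) = (2 * m + s - 1) / (α + m) := by
      rw [hahnRatio]; push_cast
      rw [← hm]
      field_simp; rw [hs]; ring
    rw [this, hahnDown, hahnRatio]; push_cast
    rw [← hm, show m + α + β + 1 = m + s by rw [hs]; ring,
      show 2 * m + α + β + 1 = 2 * m + s by rw [hs]; ring]
    field_simp
  rw [hA, hC]
  simp only [hahnCoeff]
  push_cast
  rw [show -((i : ℝ) + 2) = -(m + 1) by rw [hm]; ring,
    show (i : ℝ) + 2 + α + β + 1 = m + 1 + s by rw [hm, hs]; ring,
    ← hm, show m + α + β + 1 = m + s by rw [hs]; ring,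
    show -(i : ℝ) = -(m - 1) by rw [hm]; ring,
    show (i : ℝ) + α + β + 1 = m - 1 + s by rw [hm, hs]; ring,
    e1, e2, e3, e4, e5, e6, ← hX, ← hY, risingFactorial_succ (α + 1), risingFactorial_succ (-(N : ℝ)),
    Nat.factorial_succ]
  push_cast
  have hβs : β = s - 1 - α := by rw [hs]; ring
  rw [hβs]
  clear_value X Y m s
  set G : ℝ := ((j : ℝ) + 1) * j.factorial * (risingFactorial (α + 1) j * (α + 1 + j)) *
    (risingFactorial (-(N : ℝ)) j * (-N + j)) with hG
  have d0 : X * Y / (j.factorial * risingFactorial (α + 1) j * risingFactorial (-(N : ℝ)) j) =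
      (j + 1) * (α + 1 + j) * (-N + j) * (X * Y / G) := by
    rw [hG]; field_simp
  clear_value G
  have d1 : -(m + 1) * X * (Y * (m + s + j) * (m + s + j + 1) / (m + s)) / G -
      X * (-m + j) * (Y * (m + s + j)) / G =
      -(j + 1) * (m + s + j) * (2 * m + s + 1) / (m + s) * (X * Y / G) := by
    have : -(m + 1) * ((m + s + j + 1) / (m + s)) - (-m + j) =
      -(j + 1) * (2 * m + s + 1) / (m + s) := by field_simp; ring
    linear_combination X * Y * (m + s + j) / G * this
  have d2 : X * (-m + j) * (Y * (m + s + j)) / G -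
      X * (-m + j) * (-m + j + 1) / -m * ((m - 1 + s) * Y) / G =
      (j + 1) * (-m + j) * (2 * m + s - 1) / m * (X * Y / G) := by
    have : (m + s + j) - (-m + j + 1) / -m * (m - 1 + s) =
      (j + 1) * (2 * m + s - 1) / m := by field_simp; ring
    linear_combination X * Y * (-m + j) / G * this
  have d3 : (m + s) * (N - m) * (α + m + 1) / ((2 * m + s) * (2 * m + s + 1)) *
      (-(j + 1) * (m + s + j) * (2 * m + s + 1) / (m + s)) =
      -(j + 1) * (N - m) * (α + m + 1) * (m + s + j) / (2 * m + s) := by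
    rw [div_mul_div_comm, div_eq_div_iff (mul_ne_zero (mul_ne_zero h2 h3) hms) h2]; ring
  have d4 : m * (m + s + N) * (s - 1 - α + m) / ((2 * m + s) * (2 * m + s - 1)) *
      ((j + 1) * (-m + j) * (2 * m + s - 1) / m) =
      (j + 1) * (m + s + N) * (s - 1 - α + m) * (-m + j) / (2 * m + s) := by
    rw [div_mul_div_comm, div_eq_div_iff (mul_ne_zero (mul_ne_zero h2 h4) hm0) h2]; ring
  have d5 : -(j + 1) * (N - m) * (α + m + 1) * (m + s + j) / (2 * m + s) -
      (j + 1) * (m + s + N) * (s - 1 - α + m) * (-m + j) / (2 * m + s) =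
      (j + 1) * (α + 1 + j) * (-N + j) - (j + 1) * ((-m + j) * (m + s + j)) := by
    rw [← sub_div, div_eq_iff h2]; ring
  rw [d1, d2, d0, ← mul_assoc, ← mul_assoc, d3, d4]
  linear_combination (X * Y / G) * d5

theorem hahnQ_recurrence (N : ℕ) (α β : ℝ) (hα : α < -(N : ℝ)) (hβ : β < -(N : ℝ))
    (x : ℝ) (i : ℕ) (hi : i + 2 ≤ N) :
    hahnUp α β N (i + 1) / (1 + hahnRatio α β (i + 2)) *
        (hahnQ (i + 2) x α β N - hahnQ (i + 1) x α β N) =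
      hahnDown α β N (i + 1) * hahnRatio α β (i + 1) / (1 + hahnRatio α β (i + 1)) *
        (hahnQ (i + 1) x α β N - hahnQ i x α β N) - x * hahnQ (i + 1) x α β N := by
  set A := hahnUp α β N (i + 1) / (1 + hahnRatio α β (i + 2)) with hA
  set C := hahnDown α β N (i + 1) * hahnRatio α β (i + 1) / (1 + hahnRatio α β (i + 1)) with hC
  have hx : -x * hahnQ (i + 1) x α β N = ∑ j ∈ Finset.range (i + 2),
      (hahnCoeff (i + 1) α β N j - (j + 1) * hahnCoeff (i + 1) α β N (j + 1)) *
        risingFactorial (-x) (j + 1) := by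
    -- Uses -x (-x)_j = (-x)_{j+1} - j (-x)_j. The top term of the second sum vanishes; dropping k =
    -- 0 as well aligns the two ranges.
    have h₁ : -x * hahnQ (i + 1) x α β N =
        ∑ j ∈ Finset.range (i + 2),
            hahnCoeff (i + 1) α β N j * risingFactorial (-x) (j + 1) -
          ∑ k ∈ Finset.range (i + 3), k * hahnCoeff (i + 1) α β N k * risingFactorial (-x) k := by
      rw [Finset.sum_range_succ _ (i + 2),
        show hahnCoeff (i + 1) α β N (i + 2) = 0 by
          rw [hahnCoeff, risingFactorial_neg_natCast_of_lt (by omega)]; simp,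
        hahnQ_eq_sum (M := i + 2) le_rfl, Finset.mul_sum, mul_zero, zero_mul, add_zero,
        ← Finset.sum_sub_distrib]
      refine Finset.sum_congr rfl fun j _ => ?_
      rw [risingFactorial_succ]; ring
    rw [h₁, Finset.sum_range_succ' _ (i + 2)]
    simp only [Nat.cast_zero, zero_mul, add_zero]
    rw [← Finset.sum_sub_distrib]
    refine Finset.sum_congr rfl fun j _ => ?_
    push_cast; ring
  have key : A * (hahnQ (i + 2) x α β N - hahnQ (i + 1) x α β N) -
      C * (hahnQ (i + 1) x α β N - hahnQ i x α β N) = -x * hahnQ (i + 1) x α β N := by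
    rw [hx, hahnQ_eq_sum (n := i + 2) (M := i + 3) (by omega),
      hahnQ_eq_sum (n := i + 1) (M := i + 3) (by omega),
      hahnQ_eq_sum (n := i) (M := i + 3) (by omega),
      ← Finset.sum_sub_distrib, ← Finset.sum_sub_distrib, Finset.mul_sum, Finset.mul_sum,
      ← Finset.sum_sub_distrib, Finset.sum_range_succ']
    simp only [hahnCoeff_zero, sub_self, mul_zero, add_zero]
    refine Finset.sum_congr rfl fun j hj => ?_
    rw [← hahnCoeff_recurrence N α β hα hβ i hi j (by
      have := Finset.mem_range.1 hj; omega)]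
    ring
  linarith

/-! ### A discrete Sonine function for three-term recurrences -/

/-- One step of the monotonicity of the discrete Sonine function
`((N-x)(y-p)² + x(y+ρp)²) / (1+ρ)²`. -/
theorem sonine_step {N x a c ρ σ p y z : ℝ} (hxN : x ≤ N) (hρ : 0 < ρ) (hρ1 : ρ ≤ 1)
    (hσ : 0 < σ) (ha : 0 < a) (hca : c ≤ a) (hac : a + c = N)
    (h : a / (1 + σ) * (z - y) = c * ρ / (1 + ρ) * (y - p) - x * y) :
    ((N - x) * (z - y) ^ 2 + x * (z + σ * y) ^ 2) / (1 + σ) ^ 2 ≤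
      ((N - x) * (y - p) ^ 2 + x * (y + ρ * p) ^ 2) / (1 + ρ) ^ 2 := by
  have hρ' : 0 < 1 + ρ := by linarith
  have hσ' : 0 < 1 + σ := by linarith
  -- In these coordinates the Sonine function is the diagonal form (N-x)u² + xv², with y = ρu + v.
  set u := (y - p) / (1 + ρ) with hu
  set v := (y + ρ * p) / (1 + ρ) with hv
  set u' := (z - y) / (1 + σ) with hu'
  set v' := (z + σ * y) / (1 + σ) with hv'
  have hy : y = ρ * u + v := by rw [hu, hv]; field_simp; ring
  have hvu : v' = u' + y := by rw [hu', hv']; field_simp; ring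
  have h1 : a * u' = c * ρ * u - x * y := by
    rw [hu', hu]; rw [div_mul_eq_mul_div, div_mul_eq_mul_div] at h
    rw [← mul_div_assoc, ← mul_div_assoc]; exact h
  have h2 : a * v' = (N - x) * y - c * v := by
    linear_combination a * hvu + h1 + y * hac - c * hy
  have hL : ((N - x) * (z - y) ^ 2 + x * (z + σ * y) ^ 2) / (1 + σ) ^ 2 =
      (N - x) * u' ^ 2 + x * v' ^ 2 := by rw [hu', hv']; field_simp
  have hR : ((N - x) * (y - p) ^ 2 + x * (y + ρ * p) ^ 2) / (1 + ρ) ^ 2 =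
      (N - x) * u ^ 2 + x * v ^ 2 := by rw [hu, hv]; field_simp
  rw [hL, hR]
  clear_value u v u' v'
  have ha2 : 0 < a ^ 2 := by positivity
  refine le_of_mul_le_mul_left ?_ ha2
  -- The decrease splits into one term controlled by c ≤ a and one by ρ ≤ 1.
  have e : a ^ 2 * ((N - x) * u ^ 2 + x * v ^ 2) - a ^ 2 * ((N - x) * u' ^ 2 + x * v' ^ 2) =
      (a - c) * ((N - x) * (ρ * u) - x * v) ^ 2 + (N - x) * u ^ 2 * (a ^ 2 * (1 - ρ ^ 2)) := by
    have e1 : a ^ 2 * ((N - x) * u' ^ 2 + x * v' ^ 2) =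
        (N - x) * (c * ρ * u - x * y) ^ 2 + x * ((N - x) * y - c * v) ^ 2 := by
      rw [← h1, ← h2]; ring
    rw [e1, hy, ← hac]; ring
  have h3 : 0 ≤ (a - c) * ((N - x) * (ρ * u) - x * v) ^ 2 :=
    mul_nonneg (sub_nonneg.2 hca) (sq_nonneg _)
  have h4 : 0 ≤ (N - x) * u ^ 2 * (a ^ 2 * (1 - ρ ^ 2)) := by
    have : 0 ≤ 1 - ρ ^ 2 := by nlinarith
    have : 0 ≤ N - x := by linarith
    positivity
  linarith

theorem abs_le_one_of_recurrence {N x : ℝ} {n : ℕ} {Q ρ a c : ℕ → ℝ} (hx : 0 < x) (hxN : x < N)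
    (hρ : ∀ m, 1 ≤ m → m ≤ n → 0 < ρ m ∧ ρ m ≤ 1)
    (hQ0 : Q 0 = 1) (hQ1 : Q 1 = 1 - x * (1 + ρ 1) / N)
    (hac : ∀ i, i + 2 ≤ n → 0 < a (i + 1) ∧ c (i + 1) ≤ a (i + 1) ∧ a (i + 1) + c (i + 1) = N)
    (hrec : ∀ i, i + 2 ≤ n → a (i + 1) / (1 + ρ (i + 2)) * (Q (i + 2) - Q (i + 1)) =
      c (i + 1) * ρ (i + 1) / (1 + ρ (i + 1)) * (Q (i + 1) - Q i) - x * Q (i + 1)) :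
    |Q n| ≤ 1 := by
  have hN : 0 < N := hx.trans hxN
  have hS : ∀ i, i + 1 ≤ n →
      ((N - x) * (Q (i + 1) - Q i) ^ 2 + x * (Q (i + 1) + ρ (i + 1) * Q i) ^ 2) /
        (1 + ρ (i + 1)) ^ 2 ≤ x * (N - x) / N := by
    intro i
    induction i with
    | zero =>
      intro h
      have h1 := (hρ 1 le_rfl h).1
      have h2 : 1 + ρ 1 ≠ 0 := by positivity
      rw [zero_add, hQ0, hQ1]
      refine le_of_eq ?_
      field_simp
      ring
    | succ i ih =>
      intro h
      have h1 := hρ (i + 1) (by omega) (by omega)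
      have h2 := hac i h
      exact (sonine_step hxN.le h1.1 h1.2 (hρ (i + 2) (by omega) h).1 h2.1 h2.2.1 h2.2.2
        (hrec i h)).trans (ih (by omega))
  cases n with
  | zero => simp [hQ0]
  | succ i =>
    obtain ⟨h0, h1⟩ := hρ (i + 1) (by omega) le_rfl
    have h := hS i le_rfl
    set y := Q (i + 1)
    set p := Q i
    set r := ρ (i + 1)
    rw [div_le_div_iff₀ (by positivity) hN] at h
    have hNx : 0 < N - x := by linarith
    -- Cauchy-Schwarz for y(1+r) = r(y-p) + (y+rp), with its defect written out.
    have e : ((N - x) * (y - p) ^ 2 + x * (y + r * p) ^ 2) * N -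
        x * (N - x) * (y ^ 2 * (1 + r) ^ 2) =
        ((N - x) * (r * (y - p)) - x * (y + r * p)) ^ 2 +
          N * (N - x) * (y - p) ^ 2 * (1 - r ^ 2) := by ring
    have h2 : 0 ≤ N * (N - x) * (y - p) ^ 2 * (1 - r ^ 2) := by
      have : 0 ≤ 1 - r ^ 2 := by nlinarith
      positivity
    have h3 : x * (N - x) * (1 + r) ^ 2 * y ^ 2 ≤ x * (N - x) * (1 + r) ^ 2 * 1 := by
      nlinarith [sq_nonneg ((N - x) * (r * (y - p)) - x * (y + r * p))]
    have h4 := le_of_mul_le_mul_left h3 (by positivity)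
    exact abs_le_one_iff_mul_self_le_one.2 (by nlinarith)

/-- The reflection `x ↦ N - x` of `abs_le_one_of_recurrence`. -/
theorem abs_le_of_recurrence {N x : ℝ} {n : ℕ} {Q ρ a c r : ℕ → ℝ} (hx : 0 < x) (hxN : x < N)
    (hρ : ∀ m, 1 ≤ m → m ≤ n → 1 ≤ ρ m) (hr0 : r 0 = 1)
    (hr : ∀ m, m + 1 ≤ n → r (m + 1) = r m * ρ (m + 1)) (hrpos : ∀ m, m ≤ n → 0 < r m)
    (hQ0 : Q 0 = 1) (hQ1 : Q 1 = 1 - x * (1 + ρ 1) / N)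
    (hac : ∀ i, i + 2 ≤ n → 0 < a (i + 1) ∧ c (i + 1) ≤ a (i + 1) ∧ a (i + 1) + c (i + 1) = N)
    (hrec : ∀ i, i + 2 ≤ n → a (i + 1) / (1 + ρ (i + 2)) * (Q (i + 2) - Q (i + 1)) =
      c (i + 1) * ρ (i + 1) / (1 + ρ (i + 1)) * (Q (i + 1) - Q i) - x * Q (i + 1)) :
    |Q n| ≤ r n := by
  have hN : 0 < N := hx.trans hxN
  rcases Nat.eq_zero_or_pos n with rfl | hn
  · simp [hQ0, hr0]
  -- Dividing by (-1)^m r_m normalizes the reflected sequence to 1 at m = 0 and inverts every ratio.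
  have h := abs_le_one_of_recurrence (N := N) (x := N - x) (n := n)
    (Q := fun m => (-1) ^ m * Q m / r m) (ρ := fun m => (ρ m)⁻¹) (a := a) (c := c)
    (by linarith) (by linarith)
    (fun m h1 h2 => ⟨inv_pos.2 (by linarith [hρ m h1 h2]), inv_le_one_of_one_le₀ (hρ m h1 h2)⟩)
    (by simp [hQ0, hr0])
    (by
      have := hρ 1 le_rfl hn
      have h1 : ρ 1 ≠ 0 := by positivity
      have h2 := hr 0 hn
      rw [hr0, one_mul, zero_add] at h2
      simp only [hQ1, h2]
      field_simp
      ring)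
    hac
    (by
      intro i hi
      have h1 := hρ (i + 1) (by omega) (by omega)
      have h2 := hρ (i + 2) (by omega) hi
      have e := hrec i hi
      have e2 := (hac i hi).2.2
      have hri := hrpos i (by omega)
      have er1 := hr i (by omega)
      have er2 : r (i + 2) = r (i + 1) * ρ (i + 2) := hr (i + 1) hi
      rw [er1] at er2
      simp only [pow_succ, er1, er2, ← e2]
      generalize Q (i + 2) = z at *
      generalize Q (i + 1) = y at *
      generalize Q i = p at *
      generalize ρ (i + 1) = s at *
      generalize ρ (i + 2) = t at *
      generalize a (i + 1) = A at *
      generalize c (i + 1) = C at *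
      generalize r i = R at *
      have hs : 0 < s := by linarith
      have ht : 0 < t := by linarith
      have i1 : A / (1 + t⁻¹) = A / (1 + t) * t := by field_simp; ring
      have i2 : C * s⁻¹ / (1 + s⁻¹) = C * s / (1 + s) * s⁻¹ := by field_simp; ring
      have i3 : A = A / (1 + t) * t + A / (1 + t) := by field_simp; ring
      have i4 : C = C * s / (1 + s) * s⁻¹ + C * s / (1 + s) := by field_simp
      rw [i1, i2]
      generalize A / (1 + t) = A' at *
      generalize C * s / (1 + s) = C' at *
      rw [i3, i4]
      field_simp
      linear_combination s * e)
  have hrn := hrpos n le_rfl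
  rw [abs_div, abs_mul, abs_pow, abs_neg, abs_one, one_pow, one_mul, abs_of_pos hrn,
    div_le_one hrn] at h
  exact h

/-! ### The bound -/

theorem hahnRatio_pos {N : ℕ} {α β : ℝ} (hα : α < -(N : ℝ)) (hβ : β < -(N : ℝ)) {m : ℕ}
    (hm : m ≤ N) : 0 < hahnRatio α β m := by
  have : (m : ℝ) ≤ N := by exact_mod_cast hm
  exact div_pos_of_neg_of_neg (by linarith) (by linarith)

theorem hahnUp_add_hahnDown {N : ℕ} {α β : ℝ} (hαβ : α + β < -2 * (N : ℝ) - 1) {m : ℕ}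
    (hm : m ≤ N) : hahnUp α β N m + hahnDown α β N m = N := by
  have : (m : ℝ) ≤ N := by exact_mod_cast hm
  have h : 2 * (m : ℝ) + α + β + 1 ≠ 0 := ne_of_lt (by linarith)
  rw [hahnUp, hahnDown, ← add_div, div_eq_iff h]
  ring

theorem hahnUp_pos {N : ℕ} {α β : ℝ} (hαβ : α + β < -2 * (N : ℝ) - 1) {m : ℕ}
    (hm : m < N) : 0 < hahnUp α β N m := by
  have h : (m : ℝ) < N := by exact_mod_cast hm
  have h0 : (0 : ℝ) ≤ m := Nat.cast_nonneg m
  exact div_pos_of_neg_of_neg (mul_neg_of_neg_of_pos (by linarith) (by linarith)) (by linarith)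

/-- Below the degree bound the upward weight dominates. -/
theorem hahnDown_le_hahnUp {N : ℕ} {α β : ℝ} (hαβ : α + β < -2 * (N : ℝ) - 1) {m : ℕ}
    (hm : m ≤ N) (hb : (m : ℝ) + 1 ≤ degreeBound α β N) :
    hahnDown α β N m ≤ hahnUp α β N m := by
  have h : (m : ℝ) ≤ N := by exact_mod_cast hm
  have h0 : (0 : ℝ) ≤ m := Nat.cast_nonneg m
  have hs : Real.sqrt ((α + β + 1) * (α + β + 1 + 2 * (N : ℝ))) ≤ -(α + β + 1) - 2 * m := by
    rw [degreeBound] at hb; linarith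
  have hsq := (Real.sqrt_le_left (by linarith)).1 hs
  rw [hahnDown, hahnUp]
  -- The common denominator is negative, so the numerators compare in reverse; expanded, that is
  -- `hsq`.
  refine div_le_div_of_nonpos_of_le (by linarith) ?_
  nlinarith

/-- At x = N = a + c, the inductive relation y = -sp turns the c-term into cy; this leaves
a(z-y)/(1+t) = -ay, and a ≠ 0. -/
theorem hahnQ_at_natCast (N : ℕ) (α β : ℝ) (hα : α < -(N : ℝ)) (hβ : β < -(N : ℝ))
    (hαβ : α + β < -2 * (N : ℝ) - 1) (n : ℕ) (hn : n + 1 ≤ N) :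
    hahnQ (n + 1) N α β N = -hahnRatio α β (n + 1) * hahnQ n N α β N := by
  have hNpos : (0 : ℝ) < N := by exact_mod_cast (by omega : 0 < N)
  have hN1 : (1 : ℝ) ≤ N := by exact_mod_cast (by omega : 1 ≤ N)
  induction n with
  | zero =>
    have : α + 1 ≠ 0 := ne_of_lt (by linarith)
    rw [zero_add, hahnQ_one _ _ _ _ this hNpos.ne', hahnQ_zero_left, hahnRatio]
    push_cast
    field_simp
    ring
  | succ i ih =>
    have e := hahnQ_recurrence N α β hα hβ N i hn
    have hi := ih (by omega)
    have ha := hahnUp_pos hαβ (m := i + 1) (by omega)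
    have hac := hahnUp_add_hahnDown hαβ (m := i + 1) (by omega)
    have hs := hahnRatio_pos hα hβ (m := i + 1) (by omega)
    have ht := hahnRatio_pos hα hβ (m := i + 2) (by omega)
    rw [show i + 1 + 1 = i + 2 from rfl]
    generalize hahnQ (i + 2) N α β N = z at *
    generalize hahnQ (i + 1) N α β N = y at *
    generalize hahnQ i N α β N = p at *
    generalize hahnRatio α β (i + 1) = s at *
    generalize hahnRatio α β (i + 2) = t at *
    generalize hahnUp α β N (i + 1) = A at *
    generalize hahnDown α β N (i + 1) = C at *
    have h1 : 1 + s ≠ 0 := by positivity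
    have h2 : 1 + t ≠ 0 := by positivity
    rw [← hac, hi] at e
    rw [hi]
    field_simp at e
    have h3 : A * (1 + s) * (z - -t * (-s * p)) = 0 := by linear_combination e
    have h4 := (mul_eq_zero.1 h3).resolve_left (by positivity)
    linarith

theorem theorem3p8 (N : ℕ) (α β : ℝ) (hα : α < -(N : ℝ)) (hβ : β < -(N : ℝ))
    (hαβ : α + β < -2 * (N : ℝ) - 1) (n : ℕ) (hnN : n ≤ N)
    (hn : (n : ℝ) ≤ degreeBound α β N) :
    (∀ x ∈ Set.Icc (0 : ℝ) (N : ℝ),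
      |hahnQ n x α β N| ≤ max 1 (risingFactorial (β + 1) n / risingFactorial (α + 1) n)) ∧
    max 1 (risingFactorial (β + 1) n / risingFactorial (α + 1) n) =
      max |hahnQ n 0 α β N| |hahnQ n (N : ℝ) α β N| := by
  -- Reaching degree n only uses the weights of index at most n - 1.
  have hn' : ∀ i, i + 2 ≤ n → ((i + 1 : ℕ) : ℝ) + 1 ≤ degreeBound α β N := fun i hi => by
    have : ((i + 2 : ℕ) : ℝ) ≤ n := by exact_mod_cast hi
    push_cast at this ⊢
    linarith
  obtain ⟨r, hr0, hr⟩ : ∃ r : ℕ → ℝ, r 0 = 1 ∧ ∀ m, r (m + 1) = r m * hahnRatio α β (m + 1) :=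
    ⟨fun m => ∏ k ∈ Finset.range m, hahnRatio α β (k + 1), by simp,
      fun m => Finset.prod_range_succ _ _⟩
  have hrr : ∀ m, risingFactorial (β + 1) m / risingFactorial (α + 1) m = r m := by
    intro m
    induction m with
    | zero => simp [hr0, risingFactorial_zero]
    | succ m ih =>
      rw [hr, ← ih, risingFactorial_succ, risingFactorial_succ, hahnRatio, mul_div_mul_comm]
      push_cast
      ring_nf
  have hrpos : ∀ m, m ≤ N → 0 < r m := by
    intro m
    induction m with
    | zero => simp [hr0]
    | succ m ih =>
      intro hm
      rw [hr]
      exact mul_pos (ih (by omega)) (hahnRatio_pos hα hβ hm)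
  have hQN : ∀ m, m ≤ N → |hahnQ m N α β N| = r m := by
    intro m
    induction m with
    | zero => simp [hr0, hahnQ_zero_left]
    | succ m ih =>
      intro hm
      rw [hahnQ_at_natCast N α β hα hβ hαβ m hm, abs_mul, abs_neg, ih (by omega), hr,
        abs_of_pos (hahnRatio_pos hα hβ hm), mul_comm]
  rw [hrr]
  refine ⟨fun x hx => ?_, by rw [hahnQ_at_zero, hQN n hnN, abs_one]⟩
  -- At the endpoints x(N-x) = 0 and the Sonine bound is void; the explicit values serve instead.
  rcases hx.1.eq_or_lt with rfl | hx0
  · rw [hahnQ_at_zero, abs_one]; exact le_max_left _ _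
  rcases hx.2.eq_or_lt with rfl | hxN
  · rw [hQN n hnN]; exact le_max_right _ _
  have hNpos : (0 : ℝ) < N := hx0.trans hxN
  have hN1 : (1 : ℝ) ≤ N := by exact_mod_cast hNpos
  have hQ1 : hahnQ 1 x α β N = 1 - x * (1 + hahnRatio α β 1) / N := by
    have : α + 1 ≠ 0 := ne_of_lt (by linarith)
    rw [hahnQ_one _ _ _ _ this hNpos.ne', hahnRatio]
    push_cast
    field_simp
    ring
  have hac : ∀ i, i + 2 ≤ n → 0 < hahnUp α β N (i + 1) ∧
      hahnDown α β N (i + 1) ≤ hahnUp α β N (i + 1) ∧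
      hahnUp α β N (i + 1) + hahnDown α β N (i + 1) = N := fun i hi =>
    ⟨hahnUp_pos hαβ (by omega), hahnDown_le_hahnUp hαβ (by omega) (hn' i hi),
      hahnUp_add_hahnDown hαβ (by omega)⟩
  have hrec := fun i (hi : i + 2 ≤ n) => hahnQ_recurrence N α β hα hβ x i (hi.trans hnN)
  have hneg : ∀ m, m ≤ n → α + (m : ℝ) < 0 := fun m hm => by
    have : (m : ℝ) ≤ N := by exact_mod_cast hm.trans hnN
    linarith
  rcases le_total α β with h | h
  · refine le_max_of_le_left (abs_le_one_of_recurrence (Q := fun m => hahnQ m x α β N) hx0 hxN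
      (fun m _ hm => ⟨hahnRatio_pos hα hβ (hm.trans hnN), ?_⟩) (hahnQ_zero_left _ _ _ _) hQ1
      hac hrec)
    exact (div_le_one_of_neg (hneg m hm)).2 (by linarith)
  · refine le_max_of_le_right (abs_le_of_recurrence (Q := fun m => hahnQ m x α β N) hx0 hxN
      (fun m _ hm => ?_) hr0 (fun m _ => hr m) (fun m hm => hrpos m (hm.trans hnN))
      (hahnQ_zero_left _ _ _ _) hQ1 hac hrec)
    exact (one_le_div_of_neg (hneg m hm)).2 (by linarith)
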